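/- Let $\alpha>-1$, $\beta\in\mathbb{R}$ and $0<k^2<1$. Let $P_n$, $n\ge 0$, be the monic polynomials orthogonal on $[-1,1]$ with respect to the weight $w(x)=(1-x^2)^{\alpha}(1-k^2x^2)^{\beta}$, let $h_n=\int_{-1}^{1}P_n(x)^2w(x)\,dx$, and let $\beta_0=0$ and $\beta_n=h_n/h_{n-1}$ for $n\ge 1$ be the recurrence coefficients, so that $xP_n=P_{n+1}+\beta_nP_{n-1}$. Then for every $n\ge 0$ \[ \begin{aligned} &(\beta_{n+1}-\beta_n)^2\Big\{4k^4\beta_n\Big[\big(\alpha+\beta+n+\tfrac32\big)\big(\alpha+\beta+n-\tfrac12\big)\beta_{n+1}+\big(\alpha+\beta+n+\tfrac12\big)\big(\alpha+\beta+n-\tfrac32\big)\beta_{n-1}\Big]\\ &\qquad+4k^2\big(\alpha+\beta+n+\tfrac12\big)\big(\alpha+\beta+n-\tfrac12\big)\beta_n\big(2k^2\beta_n-k^2-1\big)+(\alpha k^2+\beta)^2+k^2n(n+2\alpha+2\beta)\Big\}\\ &=\Big\{\beta_{n+1}\Big[k^2\big(\alpha+\beta+n+\tfrac52\big)(\beta_{n+2}+\beta_{n+1})-(k^2+1)\big(\alpha+\beta+n+\tfrac32\big)\Big]\\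 &\qquad-\beta_n\Big[k^2\big(\alpha+\beta+n+\tfrac12\big)(\beta_n+\beta_{n-1})-(k^2+1)\big(\alpha+\beta+n-\tfrac12\big)\Big]\\ &\qquad+\tfrac12+2k^2\beta_n\Big[\big(\alpha+\beta+n+\tfrac12\big)(\beta_{n+1}-\beta_n)+\beta_n+\beta_{n-1}\Big]\Big\}^2, \end{aligned} \] where for $n=0$ the number $\beta_{-1}$ may be given any value (it is multiplied by $\beta_0=0$). For every $n\ge 0$, the difference of the two sides, as a polynomial in four indeterminates $\beta_{n-1},\beta_n,\beta_{n+1},\beta_{n+2}$, has degree exactly $4$ in $(\beta_n,\beta_{n+1})$ jointly and degree exactly $2$ in $(\beta_{n-1},\beta_{n+2})$ jointly. Taken one at a time, its degree is $4$ in $\beta_n$ and $2$ in $\beta_{n-1}$ unless $\alpha+\beta+n=\tfrac32$, and $4$ in $\beta_{n+1}$ and $2$ in $\beta_{n+2}$ unless $\alpha+\beta+n=-\tfrac52$. -/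

import Mathlib

open scoped Polynomial

noncomputable section

/-- The weight `(1 - x²)^a (1 - k²x²)^b`, used on the interval `[-1, 1]`. -/
def deformedJacobiWeight (a b k x : ℝ) : ℝ :=
  (1 - x ^ 2) ^ a * (1 - k ^ 2 * x ^ 2) ^ b

/-- The bilinear form `∫_{-1}^{1} p(x) q(x) w(x) dx` on polynomials. -/
def weightedForm (w : ℝ → ℝ) (p q : ℝ[X]) : ℝ :=
  ∫ x in (-1 : ℝ)..1, p.eval x * q.eval x * w x

/-- The monic orthogonal polynomials for the weight `w` on `[-1, 1]`: the Gram-Schmidt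
orthogonalization, without normalization, of the monomials `1, x, x², …`. -/
def monicOrthPoly (w : ℝ → ℝ) (n : ℕ) : ℝ[X] :=
  Polynomial.X ^ n - ∑ j : Fin n,
    Polynomial.C (weightedForm w (Polynomial.X ^ n) (monicOrthPoly w j)
      / weightedForm w (monicOrthPoly w j) (monicOrthPoly w j)) * monicOrthPoly w j
termination_by n
decreasing_by all_goals exact j.isLt

/-- The squared norm `h_n` of the `n`-th monic orthogonal polynomial. -/
def orthNormSq (w : ℝ → ℝ) (n : ℕ) : ℝ :=
  weightedForm w (monicOrthPoly w n) (monicOrthPoly w n)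

/-- The recurrence coefficients of an even weight: `β_0 = 0` and `β_n = h_n / h_{n-1}` for
`n ≥ 1`; they are the coefficients in `x P_n = P_{n+1} + β_n P_{n-1}`. -/
def recurrenceCoeff (w : ℝ → ℝ) : ℕ → ℝ
  | 0 => 0
  | n + 1 => orthNormSq w (n + 1) / orthNormSq w n

/-- The left-hand side of the third-order difference equation, with `s = a + b + n`;
the variables `z, x, y, _u` stand for `β_{n-1}, β_n, β_{n+1}, β_{n+2}`. -/
def thirdOrderLHS (a b k : ℝ) (n : ℕ) (z x y _u : ℝ) : ℝ :=
  let s : ℝ := a + b + n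
  (y - x) ^ 2 *
    (4 * k ^ 4 * x * ((s + 3 / 2) * (s - 1 / 2) * y + (s + 1 / 2) * (s - 3 / 2) * z)
      + 4 * k ^ 2 * (s + 1 / 2) * (s - 1 / 2) * x * (2 * k ^ 2 * x - k ^ 2 - 1)
      + (a * k ^ 2 + b) ^ 2 + k ^ 2 * n * (n + 2 * a + 2 * b))

/-- The right-hand side of the third-order difference equation, in the variables `z, x, y, u` that
stand for `β_{n-1}, β_n, β_{n+1}, β_{n+2}`. -/
def thirdOrderRHS (a b k : ℝ) (n : ℕ) (z x y u : ℝ) : ℝ :=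
  let s : ℝ := a + b + n
  (y * (k ^ 2 * (s + 5 / 2) * (u + y) - (k ^ 2 + 1) * (s + 3 / 2))
      - x * (k ^ 2 * (s + 1 / 2) * (x + z) - (k ^ 2 + 1) * (s - 1 / 2))
      + 1 / 2 + 2 * k ^ 2 * x * ((s + 1 / 2) * (y - x) + x + z)) ^ 2

end

/-! Put `K = k²`, `s = a + b + n`, `σ = (1 - x²)(1 - Kx²)`. The weight is semiclassical: `(σw)' =
ψw` with `ψ` cubic, so integration by parts gives `L(σp' + ψp) = 0` for every polynomial `p`
(`pearson_identity`). Computing `L(σ P_{n+1}' P_n)` once from this identity and once from the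
recurrence yields the Laguerre–Freud equation `β_{n+1} p_{n+1} - β_n p_{n-1} = 1`
(`lfResidual_eq_zero`). It is linear in the auxiliary quantity `r_n` (`ladderCoeff`), which hides
the nonlocal sum of the `β_j`, `j < n`. A second relation, quadratic in `r_n`, follows by summation.
With the ladder polynomials `A_n`, `B_n` and `v' = -w'/w`, one has `B_{n+1} + B_n + σv' = x A_n`, so
at a zero of `σ` the quantity `B_n² + σv'B_n - β_n A_n A_{n-1}` does not depend on `n`; it vanishes
at `n = 0` (`ladder_quadratic`). Combining its values at `x² = 1` and `x² = 1/K` gives `Q² = brace`,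
where `Q` is `r_n` plus local terms and the brace is the one on the left-hand side. The
Laguerre–Freud equation reads `(β_{n+1} - β_n) Q = base`, with `base` the expression squared on the
right. Squaring eliminates `r_n` (`thirdOrder_of_ladder`). The degrees are bounded above by
subadditivity of weighted degrees, and below by substituting monomials in one variable and
exhibiting a nonzero coefficient. -/

/-! ### Monic orthogonal polynomials of a positive even functional. -/

open Polynomial in
/-- A sequence of monic polynomials, the `n`-th of degree `n`, orthogonal for the functional `L`. -/
structure IsMonicOrthogonal (L : ℝ[X] →ₗ[ℝ] ℝ) (P : ℕ → ℝ[X]) : Prop where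
  monic : ∀ n, (P n).Monic
  natDegree : ∀ n, (P n).natDegree = n
  orth : ∀ m n, m ≠ n → L (P m * P n) = 0

open Polynomial in
/-- A linear map that vanishes on monic polynomials of degrees `0, …, m - 1` vanishes on all
polynomials of degree below `m`. -/
theorem linearMap_eq_zero_of_degree_lt (φ : ℝ[X] →ₗ[ℝ] ℝ) (P : ℕ → ℝ[X]) (m : ℕ)
    (hmon : ∀ j < m, (P j).Monic) (hdeg : ∀ j < m, (P j).natDegree = j)
    (h0 : ∀ j < m, φ (P j) = 0) (q : ℝ[X]) (hq : q.degree < m) : φ q = 0 := by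
  induction m generalizing q with
  | zero =>
    have : q = 0 := by simpa using hq
    simp [this]
  | succ m ih =>
    have key : φ (q - C (q.coeff m) * P m) = 0 := by
      refine ih (fun j hj => hmon j (by omega)) (fun j hj => hdeg j (by omega))
        (fun j hj => h0 j (by omega)) _ ?_
      rw [degree_lt_iff_coeff_zero]
      intro i hi
      rcases hi.eq_or_lt with rfl | hi
      · have h1 : (P m).coeff m = 1 := by
          have := (hmon m (by omega)).coeff_natDegree
          rwa [hdeg m (by omega)] at this
        simp [h1]
      · have h1 : (P m).coeff i = 0 := by
          apply coeff_eq_zero_of_natDegree_lt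
          rw [hdeg m (by omega)]; exact hi
        have h2 : q.coeff i = 0 := by
          rw [degree_lt_iff_coeff_zero] at hq
          exact hq i (by omega)
        simp [h1, h2]
    have h3 : C (q.coeff m) * P m = q.coeff m • P m := by rw [smul_eq_C_mul]
    rw [map_sub, h3, map_smul, h0 m (by omega), smul_zero, sub_zero] at key
    exact key

open Polynomial in
theorem coeff_comp_neg_X (p : ℝ[X]) (n : ℕ) : (p.comp (-X)).coeff n = (-1) ^ n * p.coeff n := by
  have : (-X : ℝ[X]) = C (-1) * X := by simp
  rw [this, comp_C_mul_X_coeff, mul_comm]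

namespace IsMonicOrthogonal

open Polynomial

variable {L : ℝ[X] →ₗ[ℝ] ℝ} {P : ℕ → ℝ[X]}

theorem map_mul_eq_zero (h : IsMonicOrthogonal L P) {q : ℝ[X]} {n : ℕ} (hq : q.degree < n) :
    L (q * P n) = 0 := by
  have := linearMap_eq_zero_of_degree_lt (L ∘ₗ LinearMap.mulRight ℝ (P n)) P n
    (fun j _ => h.monic j) (fun j _ => h.natDegree j)
    (fun j hj => by simpa using h.orth j n hj.ne) q hq
  simpa using this

/-- Such a `d` is orthogonal to all polynomials of degree below `n`, itself included, so positivity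
forces `d = 0`. This uniqueness principle gives both the parity of `P n` and the recurrence. -/
theorem eq_zero_of_degree_lt (h : IsMonicOrthogonal L P) (hpos : ∀ p : ℝ[X], p ≠ 0 → 0 < L (p * p))
    {d : ℝ[X]} {n : ℕ} (hd : d.degree < n) (h0 : ∀ j < n, L (P j * d) = 0) : d = 0 := by
  by_contra hne
  have := linearMap_eq_zero_of_degree_lt (L ∘ₗ LinearMap.mulRight ℝ d) P n
    (fun j _ => h.monic j) (fun j _ => h.natDegree j)
    (fun j hj => by simpa using h0 j hj) d hd
  exact (hpos d hne).ne' (by simpa using this)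

theorem coeff_self (h : IsMonicOrthogonal L P) (n : ℕ) : (P n).coeff n = 1 := by
  have := (h.monic n).coeff_natDegree
  rwa [h.natDegree n] at this

theorem coeff_of_lt (h : IsMonicOrthogonal L P) {n i : ℕ} (hi : n < i) : (P n).coeff i = 0 :=
  coeff_eq_zero_of_natDegree_lt (by rwa [h.natDegree n])

theorem zero_eq_one (h : IsMonicOrthogonal L P) : P 0 = 1 :=
  (h.monic 0).natDegree_eq_zero.mp (h.natDegree 0)

theorem comp_neg_X (h : IsMonicOrthogonal L P) (hpos : ∀ p : ℝ[X], p ≠ 0 → 0 < L (p * p))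
    (heven : ∀ p : ℝ[X], L (p.comp (-X)) = L p) (n : ℕ) : (P n).comp (-X) = (-1) ^ n * P n := by
  rw [← sub_eq_zero]
  have hc : ((-1 : ℝ[X]) ^ n) = C ((-1) ^ n) := by simp
  refine h.eq_zero_of_degree_lt hpos (n := n) ?_ ?_
  · rw [degree_lt_iff_coeff_zero]
    intro i hi
    rw [coeff_sub, coeff_comp_neg_X, hc, coeff_C_mul]
    rcases hi.eq_or_lt with rfl | hi
    · simp [h.coeff_self]
    · simp [h.coeff_of_lt hi]
  · intro j hj
    have h1 : L (P j * (P n).comp (-X)) = 0 := by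
      have h2 : (P j).comp (-X) * P n = (P j * (P n).comp (-X)).comp (-X) := by
        simp [mul_comp, comp_assoc]
      rw [← heven, ← h2]
      apply h.map_mul_eq_zero
      rw [degree_lt_iff_coeff_zero]
      intro i hi
      rw [coeff_comp_neg_X, h.coeff_of_lt (by omega), mul_zero]
    have h3 : P j * ((-1) ^ n * P n) = ((-1 : ℝ) ^ n) • (P j * P n) := by
      rw [smul_eq_C_mul, hc]; ring
    rw [mul_sub, map_sub, h1, h3, map_smul, h.orth j n hj.ne, smul_zero, sub_zero]

/-- By parity `x P_n²` is odd, and an even functional kills odd polynomials. This is why the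
recurrence has no diagonal term. -/
theorem map_X_mul_sq (h : IsMonicOrthogonal L P) (hpos : ∀ p : ℝ[X], p ≠ 0 → 0 < L (p * p))
    (heven : ∀ p : ℝ[X], L (p.comp (-X)) = L p) (n : ℕ) : L (X * (P n * P n)) = 0 := by
  have h1 : (X * (P n * P n)).comp (-X) = -(X * (P n * P n)) := by
    have hs : ((-1 : ℝ[X]) ^ n) * (-1) ^ n = 1 := by rw [← mul_pow]; simp
    rw [mul_comp, mul_comp, h.comp_neg_X hpos heven, X_comp]
    linear_combination (-(X * (P n * P n))) * hs
  have h2 := heven (X * (P n * P n))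
  rw [h1, map_neg] at h2
  linarith

theorem map_X_mul_succ (h : IsMonicOrthogonal L P) (n : ℕ) :
    L (X * P n * P (n + 1)) = L (P (n + 1) * P (n + 1)) := by
  have : L ((X * P n - P (n + 1)) * P (n + 1)) = 0 := by
    apply h.map_mul_eq_zero
    rw [degree_lt_iff_coeff_zero]
    intro i hi
    obtain ⟨i, rfl⟩ : ∃ j, i = j + 1 := ⟨i - 1, by omega⟩
    rw [coeff_sub, coeff_X_mul]
    rcases hi.eq_or_lt with hi | hi
    · obtain rfl : n = i := by omega
      simp [h.coeff_self]
    · rw [h.coeff_of_lt hi, h.coeff_of_lt (by omega), sub_zero]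
  rw [sub_mul, map_sub] at this
  linarith

theorem X_mul_zero (h : IsMonicOrthogonal L P) (hpos : ∀ p : ℝ[X], p ≠ 0 → 0 < L (p * p))
    (heven : ∀ p : ℝ[X], L (p.comp (-X)) = L p) : X * P 0 = P 1 := by
  rw [← sub_eq_zero]
  refine h.eq_zero_of_degree_lt hpos (n := 1) ?_ ?_
  · rw [degree_lt_iff_coeff_zero]
    intro i hi
    obtain ⟨i, rfl⟩ : ∃ j, i = j + 1 := ⟨i - 1, by omega⟩
    rw [coeff_sub, coeff_X_mul]
    rcases hi.eq_or_lt with hi | hi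
    · obtain rfl : i = 0 := by omega
      simp [h.coeff_self]
    · rw [h.coeff_of_lt hi, h.coeff_of_lt (by omega), sub_zero]
  · intro j hj
    obtain rfl : j = 0 := by omega
    have e : P 0 * (X * P 0) = X * (P 0 * P 0) := by ring
    rw [mul_sub, map_sub, h.orth 0 1 (by norm_num), e, h.map_X_mul_sq hpos heven, sub_zero]

theorem X_mul_succ (h : IsMonicOrthogonal L P) (hpos : ∀ p : ℝ[X], p ≠ 0 → 0 < L (p * p))
    (heven : ∀ p : ℝ[X], L (p.comp (-X)) = L p) (n : ℕ) :
    X * P (n + 1) = P (n + 2) + C (L (P (n + 1) * P (n + 1)) / L (P n * P n)) * P n := by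
  set β := L (P (n + 1) * P (n + 1)) / L (P n * P n)
  have hβ : β * L (P n * P n) = L (P (n + 1) * P (n + 1)) :=
    div_mul_cancel₀ _ (hpos _ (h.monic n).ne_zero).ne'
  rw [← sub_eq_zero]
  refine h.eq_zero_of_degree_lt hpos (n := n + 2) ?_ ?_
  · rw [degree_lt_iff_coeff_zero]
    intro i hi
    obtain ⟨i, rfl⟩ : ∃ j, i = j + 1 := ⟨i - 1, by omega⟩
    rw [coeff_sub, coeff_X_mul, coeff_add, coeff_C_mul, h.coeff_of_lt (n := n) (by omega)]
    rcases hi.eq_or_lt with hi | hi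
    · obtain rfl : i = n + 1 := by omega
      simp [h.coeff_self]
    · rw [h.coeff_of_lt (by omega), h.coeff_of_lt (by omega)]; simp
  · intro j hj
    have e : P j * (X * P (n + 1) - (P (n + 2) + C β * P n))
        = X * P j * P (n + 1) - P j * P (n + 2) - β • (P j * P n) := by
      rw [smul_eq_C_mul]; ring
    rw [e, map_sub, map_sub, map_smul, h.orth j (n + 2) hj.ne, smul_eq_mul]
    rcases lt_trichotomy j n with hjn | rfl | hjn
    · rw [h.orth j n hjn.ne, h.map_mul_eq_zero]
      · simp
      · rw [degree_lt_iff_coeff_zero]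
        intro i hi
        obtain ⟨i, rfl⟩ : ∃ j, i = j + 1 := ⟨i - 1, by omega⟩
        rw [coeff_X_mul, h.coeff_of_lt (by omega)]
    · rw [h.map_X_mul_succ, hβ]; ring
    · obtain rfl : j = n + 1 := by omega
      rw [mul_assoc, h.map_X_mul_sq hpos heven, h.orth (n + 1) n (by omega)]; simp

end IsMonicOrthogonal

/-! ### Integration against a weight, and Gram–Schmidt orthogonality. -/

section WeightFunctional

open Polynomial MeasureTheory

/-- The functional `p ↦ ∫_{-1}^{1} p(x) w(x) dx` of an integrable weight. -/
noncomputable def weightFunctional (w : ℝ → ℝ) (hw : IntervalIntegrable w volume (-1) 1) :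
    ℝ[X] →ₗ[ℝ] ℝ where
  toFun p := ∫ x in (-1 : ℝ)..1, p.eval x * w x
  map_add' p q := by
    rw [← intervalIntegral.integral_add (hw.continuousOn_mul p.continuousOn)
      (hw.continuousOn_mul q.continuousOn)]
    simp [add_mul]
  map_smul' c p := by
    simp [mul_assoc]

theorem weightFunctional_apply {w : ℝ → ℝ} (hw : IntervalIntegrable w volume (-1) 1) (p : ℝ[X]) :
    weightFunctional w hw p = ∫ x in (-1 : ℝ)..1, p.eval x * w x := rfl

theorem weightedForm_eq {w : ℝ → ℝ} (hw : IntervalIntegrable w volume (-1) 1) (p q : ℝ[X]) :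
    weightedForm w p q = weightFunctional w hw (p * q) := by
  simp [weightedForm, weightFunctional_apply]

theorem weightFunctional_mul_self_pos {w : ℝ → ℝ} (hw : IntervalIntegrable w volume (-1) 1)
    (hpos : ∀ x ∈ Set.Ioo (-1 : ℝ) 1, 0 < w x) (p : ℝ[X]) (hp : p ≠ 0) :
    0 < weightFunctional w hw (p * p) := by
  -- Positivity of `w` is known only on the open interval, so the endpoint `1` of `Ioc` is discarded
  -- as a null set.
  have hae : ∀ᵐ x : ℝ, x ≠ 1 := by simp [ae_iff]
  have hnn : 0 ≤ᵐ[volume.restrict (Set.Ioc (-1 : ℝ) 1)] fun x => (p * p).eval x * w x := by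
    rw [Filter.EventuallyLE, ae_restrict_iff' measurableSet_Ioc]
    filter_upwards [hae] with x hx1 hx
    rw [eval_mul]
    exact mul_nonneg (mul_self_nonneg _) (hpos x ⟨hx.1, lt_of_le_of_ne hx.2 hx1⟩).le
  rw [weightFunctional_apply, intervalIntegral.integral_pos_iff_support_of_nonneg_ae'
    (by simpa [Set.uIoc_of_le] using hnn) (hw.continuousOn_mul (p * p).continuousOn)]
  refine ⟨by norm_num, ?_⟩
  -- The integrand is nonzero off the finitely many roots of `p`, so its support has positive
  -- measure.
  have hsub : Set.Ioo (-1 : ℝ) 1 \ (p.roots.toFinset : Set ℝ)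
      ⊆ Function.support (fun x => (p * p).eval x * w x) ∩ Set.Ioc (-1) 1 := by
    rintro x ⟨hx, hr⟩
    refine ⟨?_, Set.Ioo_subset_Ioc_self hx⟩
    have : p.eval x ≠ 0 := by
      simpa [hp] using hr
    simp [this, (hpos x hx).ne']
  refine lt_of_lt_of_le ?_ (measure_mono hsub)
  rw [measure_sdiff_null (p.roots.toFinset.finite_toSet.measure_zero _), Real.volume_Ioo]
  norm_num

theorem weightFunctional_comp_neg_X {w : ℝ → ℝ} (hw : IntervalIntegrable w volume (-1) 1)
    (heven : ∀ x, w (-x) = w x) (p : ℝ[X]) :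
    weightFunctional w hw (p.comp (-X)) = weightFunctional w hw p := by
  have := intervalIntegral.integral_comp_neg (a := -1) (b := 1) (fun x => p.eval x * w x)
  simp only [heven, neg_neg] at this
  simp only [weightFunctional_apply, eval_comp, eval_neg, eval_X, this]

theorem monicOrthPoly_degree {w : ℝ → ℝ} (n : ℕ) :
    (monicOrthPoly w n).Monic ∧ (monicOrthPoly w n).natDegree = n := by
  induction n using Nat.strong_induction_on with
  | _ n ih =>
    have hlt : (∑ j : Fin n, C (weightedForm w (X ^ n) (monicOrthPoly w j)
        / weightedForm w (monicOrthPoly w j) (monicOrthPoly w j)) * monicOrthPoly w j).degree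
        < (n : WithBot ℕ) := by
      rw [degree_lt_iff_coeff_zero]
      intro i hi
      rw [finsetSum_coeff]
      refine Finset.sum_eq_zero fun j _ => ?_
      rw [coeff_C_mul, coeff_eq_zero_of_natDegree_lt, mul_zero]
      rw [(ih j j.isLt).2]
      exact lt_of_lt_of_le j.isLt hi
    rw [monicOrthPoly]
    refine ⟨monic_X_pow_sub hlt, ?_⟩
    apply natDegree_eq_of_degree_eq_some
    rw [degree_sub_eq_left_of_degree_lt, degree_X_pow]
    rwa [degree_X_pow]

theorem isMonicOrthogonal_monicOrthPoly {w : ℝ → ℝ} (hw : IntervalIntegrable w volume (-1) 1)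
    (hpos : ∀ x ∈ Set.Ioo (-1 : ℝ) 1, 0 < w x) :
    IsMonicOrthogonal (weightFunctional w hw) (monicOrthPoly w) := by
  have key : ∀ n, ∀ i < n, weightFunctional w hw (monicOrthPoly w i * monicOrthPoly w n) = 0 := by
    intro n
    induction n using Nat.strong_induction_on with
    | _ n ih =>
      intro i hi
      have h0 : weightFunctional w hw (monicOrthPoly w i * monicOrthPoly w i) ≠ 0 :=
        (weightFunctional_mul_self_pos hw hpos _ (monicOrthPoly_degree i).1.ne_zero).ne'
      rw [monicOrthPoly.eq_def w n, mul_sub, map_sub, Finset.mul_sum, map_sum,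
        Finset.sum_eq_single (⟨i, hi⟩ : Fin n)]
      · rw [mul_left_comm, ← smul_eq_C_mul, map_smul, weightedForm_eq hw, weightedForm_eq hw,
          smul_eq_mul, div_mul_cancel₀ _ h0, mul_comm, sub_self]
      · intro j _ hj
        have hij : (j : ℕ) ≠ i := fun h => hj (Fin.ext h)
        rw [mul_left_comm, ← smul_eq_C_mul, map_smul]
        rcases lt_or_gt_of_ne hij with hlt | hgt
        · rw [mul_comm, ih i hi j hlt, smul_zero]
        · rw [ih j j.isLt i hgt, smul_zero]
      · simp
  refine ⟨fun n => (monicOrthPoly_degree n).1, fun n => (monicOrthPoly_degree n).2, ?_⟩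
  intro m n hmn
  rcases lt_or_gt_of_ne hmn with h | h
  · exact key n m h
  · rw [mul_comm]; exact key m n h

end WeightFunctional

/-! ### The deformed Jacobi weight and its Pearson equation. -/

section PearsonEquation

open Polynomial MeasureTheory

theorem one_sub_sq_pos {x : ℝ} (hx : x ∈ Set.Ioo (-1 : ℝ) 1) : 0 < 1 - x ^ 2 := by
  nlinarith [hx.1, hx.2]

theorem one_sub_mul_sq_pos {K x : ℝ} (hK0 : 0 ≤ K) (hK1 : K < 1) (hx : x ∈ Set.Icc (-1 : ℝ) 1) :
    0 < 1 - K * x ^ 2 := by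
  have : x ^ 2 ≤ 1 := by nlinarith [hx.1, hx.2]
  nlinarith [sq_nonneg x]

theorem intervalIntegrable_one_sub_sq_rpow {a : ℝ} (ha : -1 < a) :
    IntervalIntegrable (fun x : ℝ => (1 - x ^ 2) ^ a) volume (-1) 1 := by
  -- On `[0, 1]` the weight factors as `(1 - x)^a (1 + x)^a`, where only the first factor can be
  -- singular; evenness then gives the other half.
  have hright : IntervalIntegrable (fun x : ℝ => (1 - x ^ 2) ^ a) volume 0 1 := by
    have h1 : IntervalIntegrable (fun x : ℝ => (1 - x) ^ a) volume 0 1 := by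
      have := (intervalIntegral.intervalIntegrable_rpow' (a := 0) (b := 1) ha).comp_sub_left 1
      simpa using this.symm
    have h2 : ContinuousOn (fun x : ℝ => (1 + x) ^ a) (Set.uIcc 0 1) := by
      rw [Set.uIcc_of_le zero_le_one]
      intro x hx
      refine (ContinuousAt.rpow_const (by fun_prop) (Or.inl ?_)).continuousWithinAt
      linarith [hx.1]
    refine (h1.mul_continuousOn h2).congr ?_
    intro x hx
    rw [Set.uIoc_of_le zero_le_one] at hx
    simp only
    rw [← Real.mul_rpow (by linarith [hx.2]) (by linarith [hx.1])]
    congr 1; ring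
  have hleft : IntervalIntegrable (fun x : ℝ => (1 - x ^ 2) ^ a) volume (-1) 0 := by
    have := hright.comp_sub_left 0
    simpa using this.symm
  exact hleft.trans hright

theorem continuousOn_one_sub_mul_sq_rpow {K : ℝ} (hK0 : 0 ≤ K) (hK1 : K < 1) (b : ℝ) :
    ContinuousOn (fun x : ℝ => (1 - K * x ^ 2) ^ b) (Set.Icc (-1) 1) :=
  ContinuousOn.rpow_const (by fun_prop) fun _ hx =>
    Or.inl (one_sub_mul_sq_pos hK0 hK1 hx).ne'

theorem deformedJacobiWeight_intervalIntegrable {a b k : ℝ} (ha : -1 < a) (hk1 : k ^ 2 < 1) :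
    IntervalIntegrable (deformedJacobiWeight a b k) volume (-1) 1 := by
  refine (intervalIntegrable_one_sub_sq_rpow ha).mul_continuousOn ?_
  rw [Set.uIcc_of_le (by norm_num)]
  exact continuousOn_one_sub_mul_sq_rpow (sq_nonneg k) hk1 b

theorem deformedJacobiWeight_pos {a b k : ℝ} (hk1 : k ^ 2 < 1) (x : ℝ)
    (hx : x ∈ Set.Ioo (-1 : ℝ) 1) : 0 < deformedJacobiWeight a b k x :=
  mul_pos (Real.rpow_pos_of_pos (one_sub_sq_pos hx) _) (Real.rpow_pos_of_pos
    (one_sub_mul_sq_pos (sq_nonneg k) hk1 (Set.Ioo_subset_Icc_self hx)) _)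

theorem deformedJacobiWeight_neg (a b k x : ℝ) :
    deformedJacobiWeight a b k (-x) = deformedJacobiWeight a b k x := by
  simp [deformedJacobiWeight]

/-- `σ = (1 - x²)(1 - K x²)`. -/
noncomputable def pearsonSigma (K : ℝ) : ℝ[X] := 1 - C (1 + K) * X ^ 2 + C K * X ^ 4

/-- `ψ = σ' + σ w'/w` for the deformed Jacobi weight. -/
noncomputable def pearsonPsi (a b K : ℝ) : ℝ[X] :=
  C (K * (4 + 2 * a + 2 * b)) * X ^ 3 - C (2 * (1 + K) + 2 * a + 2 * b * K) * X

/-- The Pearson equation `(σ w)' = ψ w`, integrated against a polynomial. -/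
theorem pearson_identity {a b k : ℝ} (ha : -1 < a) (hk1 : k ^ 2 < 1) (p : ℝ[X]) :
    weightFunctional (deformedJacobiWeight a b k) (deformedJacobiWeight_intervalIntegrable ha hk1)
      (pearsonSigma (k ^ 2) * derivative p + pearsonPsi a b (k ^ 2) * p) = 0 := by
  set K := k ^ 2 with hK
  have hK0 : 0 ≤ K := sq_nonneg k
  have ha1 : 0 < a + 1 := by linarith
  rw [weightFunctional_apply]
  -- The antiderivative is `σ w p`. The exponent `a + 1 > 0` makes it continuous up to the endpoints
  -- and zero there.
  rw [intervalIntegral.integral_eq_sub_of_hasDerivAt_of_le (by norm_num)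
    (f := fun x => p.eval x * ((1 - x ^ 2) ^ (a + 1) * (1 - K * x ^ 2) ^ (b + 1)))]
  · norm_num [Real.zero_rpow ha1.ne']
  · refine p.continuousOn.mul (ContinuousOn.mul ?_ (continuousOn_one_sub_mul_sq_rpow hK0 hk1 _))
    exact ContinuousOn.rpow_const (by fun_prop) fun x _ => Or.inr ha1.le
  · intro x hx
    have hu := one_sub_sq_pos hx
    have hv := one_sub_mul_sq_pos hK0 hk1 (Set.Ioo_subset_Icc_self hx)
    have d1 : HasDerivAt (fun x : ℝ => 1 - x ^ 2) (-(2 * x)) x := by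
      simpa using (hasDerivAt_pow 2 x).const_sub 1
    have d2 : HasDerivAt (fun x : ℝ => 1 - K * x ^ 2) (-(K * (2 * x))) x := by
      simpa using ((hasDerivAt_pow 2 x).const_mul K).const_sub 1
    have d := (p.hasDerivAt x).mul ((d1.rpow_const (p := a + 1) (Or.inl hu.ne')).mul
      (d2.rpow_const (p := b + 1) (Or.inl hv.ne')))
    refine d.congr_deriv ?_
    simp only [add_sub_cancel_right, Real.rpow_add_one hu.ne', Real.rpow_add_one hv.ne',
      deformedJacobiWeight, pearsonSigma, pearsonPsi, Pi.mul_apply, ← hK]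
    simp only [eval_add, eval_mul, eval_sub, eval_C, eval_pow, eval_X, eval_one]
    ring
  · exact (deformedJacobiWeight_intervalIntegrable ha hk1).continuousOn_mul
      (Polynomial.continuousOn _)

end PearsonEquation

/-! ### Ladder quantities and elimination of `r_n`. -/

/-- The coefficient `r_n` of `B_n(x) = x (r_n - n K x²)` in the structure relation
`σ P_n' = -B_n P_n + β_n A_n P_{n-1}`, where `σ = (1 - x²)(1 - K x²)`. -/
noncomputable def ladderCoeff (a b K : ℝ) (β : ℕ → ℝ) (n : ℕ) : ℝ :=
  n * (1 + K) - 2 * K * (a + b + n + 1 / 2) * β n - 2 * K * ∑ j ∈ Finset.range n, β j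

theorem ladderCoeff_succ (a b K : ℝ) (β : ℕ → ℝ) (n : ℕ) :
    ladderCoeff a b K β (n + 1) = ladderCoeff a b K β n + (1 + K)
      - 2 * K * (a + b + n + 3 / 2) * β (n + 1) + 2 * K * (a + b + n - 1 / 2) * β n := by
  simp only [ladderCoeff, Finset.sum_range_succ]
  push_cast
  ring

/-- The constant term of `A_n(x) = p_n - 2K(a + b + n + 1/2) x²`, for `x, y, r` standing for
`β_n, β_{n+1}, r_n`. -/
noncomputable def ladderUpper (a b K : ℝ) (n x y r : ℝ) : ℝ :=
  2 * r + (1 + K) - 2 * K * (a + b + n + 3 / 2) * y + 2 * K * (a + b + n - 1 / 2) * x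
    + 2 * (a + b * K)

/-- The constant term `p_{n-1}` of `A_{n-1}`, for `z, x, r` standing for
`β_{n-1}, β_n, r_n`. -/
noncomputable def ladderLower (a b K : ℝ) (n z x r : ℝ) : ℝ :=
  2 * r - (1 + K) + 2 * K * (a + b + n + 1 / 2) * x - 2 * K * (a + b + n - 3 / 2) * z
    + 2 * (a + b * K)

/-- The Laguerre–Freud expression `β_{n+1} p_{n+1} - β_n p_{n-1} - 1`, for `z, x, y, u, r` standing
for `β_{n-1}, β_n, β_{n+1}, β_{n+2}, r_n`. -/
noncomputable def lfResidual (a b K : ℝ) (n z x y u r : ℝ) : ℝ :=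
  y * (2 * r + 3 * (1 + K) - 4 * K * (a + b + n + 3 / 2) * y + 4 * K * (a + b + n - 1 / 2) * x
    - 2 * K * (a + b + n + 5 / 2) * u + 2 * K * (a + b + n + 1 / 2) * y + 2 * (a + b * K))
  - x * ladderLower a b K n z x r - 1

/-- The relation `B_n² + σ v' B_n = β_n A_n A_{n-1}` at the zeros of `σ`, with `t = x²`. -/
theorem ladder_quadratic (a b K t : ℝ) (ht : 1 - (1 + K) * t + K * t ^ 2 = 0) (β : ℕ → ℝ)
    (h0 : β 0 = 0)
    (hE : ∀ n : ℕ, lfResidual a b K n (β (n - 1)) (β n) (β (n + 1)) (β (n + 2))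
      (ladderCoeff a b K β n) = 0) (n : ℕ) :
    t * (ladderCoeff a b K β n - n * K * t) ^ 2
      + 2 * t * (a + b * K - K * (a + b) * t) * (ladderCoeff a b K β n - n * K * t)
    = β n * (ladderUpper a b K n (β n) (β (n + 1)) (ladderCoeff a b K β n)
        - 2 * K * (a + b + n + 1 / 2) * t)
      * (ladderLower a b K n (β (n - 1)) (β n) (ladderCoeff a b K β n)
        - 2 * K * (a + b + n - 1 / 2) * t) := by
  induction n with
  -- Both sides vanish, since `β 0 = 0` and `r_0 = 0`.
  | zero => simp [h0, ladderCoeff]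
  | succ n ih =>
    have hn := hE n
    rw [ladderCoeff_succ]
    simp only [lfResidual, ladderUpper, ladderLower, Nat.add_sub_cancel] at *
    generalize ladderCoeff a b K β n = r at *
    push_cast
    -- The increment is `(B_{n+1} - B_n)(B_{n+1} + B_n + σv')`, whose second factor is `x A_n`. The
    -- Laguerre–Freud equation evaluates `x (B_{n+1} - B_n)` as `β_{n+1} A_{n+1} - β_n A_{n-1} - σ`,
    -- and `σ = 0` at this `t`.
    linear_combination ih - (2 * r + (1 + K) - 2 * K * (a + b + n + 3 / 2) * β (n + 1)
      + 2 * K * (a + b + n - 1 / 2) * β n + 2 * (a + b * K)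
        - 2 * K * (a + b + n + 1 / 2) * t) * (ht + hn)

theorem thirdOrder_of_ladder (a b k : ℝ) (hk0 : 0 < k ^ 2) (hk1 : k ^ 2 < 1) (β : ℕ → ℝ)
    (h0 : β 0 = 0)
    (hE : ∀ n : ℕ, lfResidual a b (k ^ 2) n (β (n - 1)) (β n) (β (n + 1)) (β (n + 2))
      (ladderCoeff a b (k ^ 2) β n) = 0) (n : ℕ) :
    thirdOrderLHS a b k n (β (n - 1)) (β n) (β (n + 1)) (β (n + 2))
      = thirdOrderRHS a b k n (β (n - 1)) (β n) (β (n + 1)) (β (n + 2)) := by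
  have hk : k ≠ 0 := by rintro rfl; simp at hk0
  have h1 := ladder_quadratic a b (k ^ 2) 1 (by ring) β h0 hE n
  have h2 := ladder_quadratic a b (k ^ 2) (1 / k ^ 2) (by field_simp; ring) β h0 hE n
  have hn := hE n
  simp only [thirdOrderLHS, thirdOrderRHS, lfResidual, ladderUpper, ladderLower] at *
  generalize ladderCoeff a b (k ^ 2) β n = r at *
  generalize β (n - 1) = z at *
  generalize β (n + 2) = u at *
  generalize β (n + 1) = y at *
  generalize β n = x at *
  generalize (n : ℝ) = m at *
  have e4 : k ^ 4 = (k ^ 2) ^ 2 := by ring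
  rw [e4]
  generalize k ^ 2 = K at *
  -- Replacing `1 / K` by `T` with `K * T = 1` keeps the remaining identities polynomial.
  obtain ⟨T, hT⟩ : ∃ T, T = 1 / K := ⟨_, rfl⟩
  have hKT : K * T = 1 := by rw [hT]; field_simp
  rw [← hT] at h2
  have key : (r + a + b * K - (1 + K) * (a + b + m) + 4 * K * (a + b + m) * x) ^ 2
      = 4 * K ^ 2 * x * ((a + b + m + 3 / 2) * (a + b + m - 1 / 2) * y
          + (a + b + m + 1 / 2) * (a + b + m - 3 / 2) * z)
      + 4 * K * (a + b + m + 1 / 2) * (a + b + m - 1 / 2) * x * (2 * K * x - K - 1)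
      + (a * K + b) ^ 2 + K * m * (m + 2 * a + 2 * b) := by
    -- Subtracting the relations at `t = 1/K` and `t = 1` cancels `x p_n p_{n-1}`; what remains is
    -- `1 - K` times a completed square identity in `r`.
    have hK1 : 1 - K ≠ 0 := by linarith
    apply mul_left_cancel₀ hK1
    have e1 : m * K * T = m := by linear_combination m * hKT
    have e2 : K * (a + b) * T = a + b := by linear_combination (a + b) * hKT
    have e3 : ∀ c, 2 * K * c * T = 2 * c := fun c => by linear_combination 2 * c * hKT
    rw [e1, e2, e3, e3] at h2
    linear_combination K * h2 - K * h1
      - ((r - m) ^ 2 + 2 * (a + b * K - (a + b)) * (r - m)) * hKT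
  -- With `hn` in the form `(y - x) Q - base = 0`, this is the factorization of `((y - x) Q)² -
  -- base²`.
  linear_combination -(y - x) ^ 2 * key + (1 / 2) * ((y - x) *
    (r + a + b * K - (1 + K) * (a + b + m) + 4 * K * (a + b + m) * x)
    + (y * (K * (a + b + m + 5 / 2) * (u + y) - (K + 1) * (a + b + m + 3 / 2))
      - x * (K * (a + b + m + 1 / 2) * (x + z) - (K + 1) * (a + b + m - 1 / 2))
      + 1 / 2 + 2 * K * x * ((a + b + m + 1 / 2) * (y - x) + x + z))) * hn

/-! ### Moments from the recurrence, and the Laguerre–Freud equation. -/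

section LaguerreFreud

open Polynomial

/-- A monic orthogonal sequence for a positive even functional, together with its recurrence
coefficients `β` and squared norms `h`. -/
structure IsEvenOrthogonal (L : ℝ[X] →ₗ[ℝ] ℝ) (P : ℕ → ℝ[X]) (β h : ℕ → ℝ) : Prop
    extends IsMonicOrthogonal L P where
  norm : ∀ n, L (P n * P n) = h n
  norm_ne : ∀ n, h n ≠ 0
  zero : β 0 = 0
  norm_succ : ∀ n, h (n + 1) = β (n + 1) * h n
  recurrence : ∀ n, X * P n = P (n + 1) + C (β n) * P (n - 1)

namespace IsEvenOrthogonal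

variable {L : ℝ[X] →ₗ[ℝ] ℝ} {P : ℕ → ℝ[X]} {β h : ℕ → ℝ}

theorem map_C_mul (L : ℝ[X] →ₗ[ℝ] ℝ) (c : ℝ) (p : ℝ[X]) : L (C c * p) = c * L p := by
  rw [← smul_eq_C_mul, map_smul, smul_eq_mul]

theorem map_mul (H : IsEvenOrthogonal L P β h) (m n : ℕ) :
    L (P m * P n) = if m = n then h n else 0 := by
  split_ifs with hmn
  · rw [hmn, H.norm]
  · exact H.orth m n hmn

/-- The truncated indices at `n = 0, 1` are harmless: there `β n * β (n - 1)` contains the factor `β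
0 = 0`. -/
theorem X_sq_mul (H : IsEvenOrthogonal L P β h) (n : ℕ) :
    X ^ 2 * P n = P (n + 2) + C (β (n + 1) + β n) * P n + C (β n * β (n - 1)) * P (n - 2) := by
  have e : X ^ 2 * P n = X * (X * P n) := by ring
  rw [e, H.recurrence n, mul_add, H.recurrence (n + 1), mul_left_comm, H.recurrence (n - 1)]
  cases n with
  | zero => simp [H.zero]
  | succ n => simp; ring

theorem map_X_mul (H : IsEvenOrthogonal L P β h) (n : ℕ) :
    L (X * (P n * P (n + 1))) = h (n + 1) := by
  have e : X * (P n * P (n + 1)) = P (n + 1) * P (n + 1) + C (β n) * (P (n - 1) * P (n + 1)) := by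
    linear_combination P (n + 1) * H.recurrence n
  rw [e, map_add, map_C_mul, H.map_mul, H.map_mul, if_pos rfl, if_neg (by omega)]
  ring

theorem map_X_sq_mul_self (H : IsEvenOrthogonal L P β h) (n : ℕ) :
    L (X ^ 2 * (P n * P n)) = (β (n + 1) + β n) * h n := by
  have e : X ^ 2 * (P n * P n) = P (n + 2) * P n + C (β (n + 1) + β n) * (P n * P n)
      + C (β n * β (n - 1)) * (P (n - 2) * P n) := by
    linear_combination P n * H.X_sq_mul n
  rw [e, map_add, map_add, map_C_mul, map_C_mul, H.map_mul, H.map_mul, H.map_mul, if_pos rfl,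
    if_neg (by omega)]
  match n with
  | 0 => simp [H.zero]
  | 1 => simp [H.zero]
  | n + 2 => simp

theorem map_X_sq_mul_add_two (H : IsEvenOrthogonal L P β h) (n : ℕ) :
    L (X ^ 2 * (P n * P (n + 2))) = h (n + 2) := by
  have e : X ^ 2 * (P n * P (n + 2)) = P (n + 2) * P (n + 2)
      + C (β (n + 1) + β n) * (P n * P (n + 2))
      + C (β n * β (n - 1)) * (P (n - 2) * P (n + 2)) := by
    linear_combination P (n + 2) * H.X_sq_mul n
  rw [e, map_add, map_add, map_C_mul, map_C_mul, H.map_mul, H.map_mul, H.map_mul, if_pos rfl,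
    if_neg (by omega), if_neg (by omega)]
  ring

theorem map_X_cube_mul (H : IsEvenOrthogonal L P β h) (n : ℕ) :
    L (X ^ 3 * (P n * P (n + 1))) = h (n + 1) * (β (n + 2) + β (n + 1) + β n) := by
  have e : X ^ 3 * (P n * P (n + 1)) = X ^ 2 * (P n * P (n + 2))
      + C (β (n + 1)) * (X ^ 2 * (P n * P n)) := by
    have := H.recurrence (n + 1)
    rw [Nat.add_sub_cancel] at this
    linear_combination X ^ 2 * P n * this
  rw [e, map_add, map_C_mul, H.map_X_sq_mul_self, H.map_X_sq_mul_add_two, H.norm_succ (n + 1),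
    H.norm_succ n]
  ring

theorem map_X_four_mul_self (H : IsEvenOrthogonal L P β h) (n : ℕ) :
    L (X ^ 4 * (P n * P n)) = h n * (β (n + 1) * (β (n + 2) + β (n + 1) + β n)
      + β n * (β (n + 1) + β n + β (n - 1))) := by
  have e : X ^ 4 * (P n * P n) = X ^ 3 * (P n * P (n + 1))
      + C (β n) * (X ^ 3 * (P n * P (n - 1))) := by
    linear_combination X ^ 3 * P n * H.recurrence n
  rw [e, map_add, map_C_mul, H.map_X_cube_mul, H.norm_succ]
  cases n with
  | zero => simp [H.zero]; ring
  | succ n =>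
    rw [Nat.add_sub_cancel, mul_comm (P (n + 1)), H.map_X_cube_mul]
    ring

theorem map_X_four_mul_add_two (H : IsEvenOrthogonal L P β h) (n : ℕ) :
    L (X ^ 4 * (P n * P (n + 2)))
      = h (n + 2) * (β (n + 3) + β (n + 2) + β (n + 1) + β n) := by
  have e : X ^ 4 * (P n * P (n + 2)) = X ^ 2 * (P (n + 2) * P (n + 2))
      + C (β (n + 1) + β n) * (X ^ 2 * (P n * P (n + 2)))
      + C (β n * β (n - 1)) * (X ^ 2 * P (n - 2) * P (n + 2)) := by
    linear_combination X ^ 2 * P (n + 2) * H.X_sq_mul n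
  rw [e, map_add, map_add, map_C_mul, map_C_mul, H.map_X_sq_mul_self, H.map_X_sq_mul_add_two]
  match n with
  | 0 => simp [H.zero]; ring
  | 1 => simp [H.zero]; ring
  | n + 2 =>
    rw [H.map_mul_eq_zero]
    · ring
    · simp only [Nat.add_sub_cancel]
      rw [degree_lt_iff_coeff_zero]
      intro i hi
      obtain ⟨i, rfl⟩ : ∃ j, i = j + 2 := ⟨i - 2, by omega⟩
      rw [coeff_X_pow_mul, H.coeff_of_lt (by omega)]

theorem map_X_four_mul_add_four (H : IsEvenOrthogonal L P β h) (n : ℕ) :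
    L (X ^ 4 * (P n * P (n + 4))) = h (n + 4) := by
  have e : X ^ 4 * (P n * P (n + 4)) = X ^ 2 * (P (n + 2) * P (n + 4))
      + C (β (n + 1) + β n) * (X ^ 2 * P n * P (n + 4))
      + C (β n * β (n - 1)) * (X ^ 2 * P (n - 2) * P (n + 4)) := by
    linear_combination X ^ 2 * P (n + 4) * H.X_sq_mul n
  have hd : ∀ m < n + 2, L (X ^ 2 * P m * P (n + 4)) = 0 := fun m hm => by
    apply H.map_mul_eq_zero
    rw [degree_lt_iff_coeff_zero]
    intro i hi
    obtain ⟨i, rfl⟩ : ∃ j, i = j + 2 := ⟨i - 2, by omega⟩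
    rw [coeff_X_pow_mul, H.coeff_of_lt (by omega)]
  rw [e, map_add, map_add, map_C_mul, map_C_mul, H.map_X_sq_mul_add_two, hd _ (by omega),
    hd _ (by omega)]
  ring

theorem map_pearsonSigma_mul (L : ℝ[X] →ₗ[ℝ] ℝ) (K : ℝ) (p : ℝ[X]) :
    L (pearsonSigma K * p) = L p - (1 + K) * L (X ^ 2 * p) + K * L (X ^ 4 * p) := by
  have e : pearsonSigma K * p = p - C (1 + K) * (X ^ 2 * p) + C K * (X ^ 4 * p) := by
    rw [pearsonSigma]; ring
  rw [e, map_add, map_sub, map_C_mul, map_C_mul]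

theorem map_pearsonPsi_mul (H : IsEvenOrthogonal L P β h) (a b K : ℝ) (n : ℕ) :
    L (pearsonPsi a b K * (P n * P (n + 1)))
      = h (n + 1) * (K * (4 + 2 * a + 2 * b) * (β (n + 2) + β (n + 1) + β n)
        - (2 * (1 + K) + 2 * a + 2 * b * K)) := by
  have e : pearsonPsi a b K * (P n * P (n + 1))
      = C (K * (4 + 2 * a + 2 * b)) * (X ^ 3 * (P n * P (n + 1)))
        - C (2 * (1 + K) + 2 * a + 2 * b * K) * (X * (P n * P (n + 1))) := by
    rw [pearsonPsi]; ring
  rw [e, map_sub, map_C_mul, map_C_mul, H.map_X_cube_mul, H.map_X_mul]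
  ring

theorem derivative_recurrence (H : IsEvenOrthogonal L P β h) (n : ℕ) :
    derivative (P (n + 1))
      = P n + X * derivative (P n) - C (β n) * derivative (P (n - 1)) := by
  have := congrArg derivative (H.recurrence n)
  simp only [derivative_mul, derivative_add, derivative_X, derivative_C] at this
  linear_combination -this

theorem map_sigma_derivative_of_lt (H : IsEvenOrthogonal L P β h) (K : ℝ) {m n : ℕ}
    (hmn : m + 3 < n) : L (pearsonSigma K * derivative (P m) * P n) = 0 := by
  have hz : ∀ i, m ≤ i → (derivative (P m)).coeff i = 0 := fun i hi => by
    rw [coeff_derivative, H.coeff_of_lt (by omega), zero_mul]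
  apply H.map_mul_eq_zero
  rw [degree_lt_iff_coeff_zero]
  intro i hi
  obtain ⟨i, rfl⟩ : ∃ j, i = j + 4 := ⟨i - 4, by omega⟩
  have e : pearsonSigma K * derivative (P m) = derivative (P m)
      - C (1 + K) * (X ^ 2 * derivative (P m)) + C K * (X ^ 4 * derivative (P m)) := by
    rw [pearsonSigma]; ring
  rw [e, coeff_add, coeff_sub, coeff_C_mul, coeff_C_mul, coeff_X_pow_mul,
    show i + 4 = (i + 2) + 2 from rfl, coeff_X_pow_mul, hz _ (by omega), hz _ (by omega),
    hz _ (by omega)]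
  ring

theorem map_sigma_derivative_add_three (H : IsEvenOrthogonal L P β h) (K : ℝ) (n : ℕ) :
    L (pearsonSigma K * derivative (P n) * P (n + 3)) = n * K * h (n + 3) := by
  induction n with
  | zero => simp [H.zero_eq_one]
  | succ n ih =>
    have e : pearsonSigma K * derivative (P (n + 1)) * P (n + 1 + 3)
        = pearsonSigma K * (P n * P (n + 4)) + pearsonSigma K * derivative (P n) * P (n + 5)
          + C (β (n + 4)) * (pearsonSigma K * derivative (P n) * P (n + 3))
          - C (β n) * (pearsonSigma K * derivative (P (n - 1)) * P (n + 4)) := by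
      have := H.recurrence (n + 4)
      rw [show n + 4 - 1 = n + 3 from rfl] at this
      rw [H.derivative_recurrence]
      linear_combination pearsonSigma K * derivative (P n) * this
    have h1 : β n * L (pearsonSigma K * derivative (P (n - 1)) * P (n + 4)) = 0 := by
      rw [H.map_sigma_derivative_of_lt K (by omega), mul_zero]
    have h2 : L (X ^ 2 * (P n * P (n + 4))) = 0 := by
      rw [← mul_assoc]
      apply H.map_mul_eq_zero
      rw [degree_lt_iff_coeff_zero]
      intro i hi
      obtain ⟨i, rfl⟩ : ∃ j, i = j + 2 := ⟨i - 2, by omega⟩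
      rw [coeff_X_pow_mul, H.coeff_of_lt (by omega)]
    rw [e, map_sub, map_add, map_add, map_C_mul, map_C_mul, h1, ih, map_pearsonSigma_mul, h2,
      H.map_X_four_mul_add_four, H.orth n (n + 4) (by omega),
      H.map_sigma_derivative_of_lt K (by omega), H.norm_succ (n + 3)]
    push_cast
    ring

/-- Differentiating the recurrence for `P (n + 1)` and moving the factor `X` onto `P (n + 2)` gives
a first-order recursion in `n` after division by the norms. Its accumulated terms form the sum of
the `β j`. -/
theorem map_sigma_derivative_succ (H : IsEvenOrthogonal L P β h) (K : ℝ) (n : ℕ) :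
    L (pearsonSigma K * derivative (P n) * P (n + 1))
      = h (n + 1) * (K * (n * (β (n + 2) + β (n + 1) + β n)
        + 2 * ∑ j ∈ Finset.range n, β j) - (1 + K) * n) := by
  induction n with
  | zero => simp [H.zero_eq_one]
  | succ n ih =>
    have e : pearsonSigma K * derivative (P (n + 1)) * P (n + 1 + 1)
        = pearsonSigma K * (P n * P (n + 2)) + pearsonSigma K * derivative (P n) * P (n + 3)
          + C (β (n + 2)) * (pearsonSigma K * derivative (P n) * P (n + 1))
          - C (β n) * (pearsonSigma K * derivative (P (n - 1)) * P (n + 2)) := by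
      have := H.recurrence (n + 2)
      rw [show n + 2 - 1 = n + 1 from rfl] at this
      rw [H.derivative_recurrence]
      linear_combination pearsonSigma K * derivative (P n) * this
    have h1 : β n * L (pearsonSigma K * derivative (P (n - 1)) * P (n + 2))
        = β n * ((n - 1) * K * h (n + 2)) := by
      cases n with
      | zero => simp [H.zero]
      | succ n =>
        rw [Nat.add_sub_cancel, show n + 1 + 2 = n + 3 from rfl, H.map_sigma_derivative_add_three]
        push_cast
        ring
    rw [e, map_sub, map_add, map_add, map_C_mul, map_C_mul, h1, ih, map_pearsonSigma_mul,
      H.map_X_four_mul_add_two, H.map_X_sq_mul_add_two, H.orth n (n + 2) (by omega),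
      H.map_sigma_derivative_add_three, Finset.sum_range_succ, H.norm_succ (n + 2),
      H.norm_succ (n + 1)]
    push_cast
    ring

/-- The Laguerre–Freud equation of the recurrence coefficients. -/
theorem lfResidual_eq_zero (H : IsEvenOrthogonal L P β h) (a b K : ℝ)
    (hL : ∀ p, L (pearsonSigma K * derivative p + pearsonPsi a b K * p) = 0) (n : ℕ) :
    lfResidual a b K n (β (n - 1)) (β n) (β (n + 1)) (β (n + 2)) (ladderCoeff a b K β n) = 0 := by
  -- The Pearson identity for `P m * P (m + 1)` transfers the derivative from one factor to the
  -- other.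
  have hX : ∀ m, L (pearsonSigma K * derivative (P (m + 1)) * P m)
      = -L (pearsonSigma K * derivative (P m) * P (m + 1))
        - L (pearsonPsi a b K * (P m * P (m + 1))) := fun m => by
    have h1 := hL (P m * P (m + 1))
    have e : pearsonSigma K * derivative (P m * P (m + 1)) + pearsonPsi a b K * (P m * P (m + 1))
        = pearsonSigma K * derivative (P m) * P (m + 1)
          + pearsonSigma K * derivative (P (m + 1)) * P m
          + pearsonPsi a b K * (P m * P (m + 1)) := by
      rw [derivative_mul]; ring
    rw [e, map_add, map_add] at h1
    linarith
  have e : pearsonSigma K * derivative (P (n + 1)) * P n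
      = pearsonSigma K * (P n * P n) + pearsonSigma K * derivative (P n) * P (n + 1)
        + C (β n) * (pearsonSigma K * derivative (P n) * P (n - 1))
        - C (β n) * (pearsonSigma K * derivative (P (n - 1)) * P n) := by
    rw [H.derivative_recurrence]
    linear_combination pearsonSigma K * derivative (P n) * H.recurrence n
  have h2 := congrArg L e
  rw [hX, map_sub, map_add, map_add, map_C_mul, map_C_mul, map_pearsonSigma_mul,
    H.map_X_four_mul_self, H.map_X_sq_mul_self, H.norm, H.map_sigma_derivative_succ,
    H.map_pearsonPsi_mul, H.norm_succ n] at h2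
  apply mul_left_cancel₀ (H.norm_ne n)
  -- For `n = 0` the two terms with index `n - 1` carry `β 0 = 0`; otherwise `hX` turns `σ P_n'
  -- P_{n-1}` into a moment already computed.
  cases n with
  | zero =>
    simp only [H.zero, lfResidual, ladderLower, ladderCoeff] at h2 ⊢
    push_cast
    simp only [Finset.sum_range_zero] at h2 ⊢
    push_cast at h2
    linear_combination h2
  | succ n =>
    rw [Nat.add_sub_cancel, hX, H.map_sigma_derivative_succ, H.map_pearsonPsi_mul] at h2
    simp only [lfResidual, ladderLower, ladderCoeff, Finset.sum_range_succ,
      Nat.add_sub_cancel] at h2 ⊢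
    push_cast at h2 ⊢
    linear_combination h2

end IsEvenOrthogonal

theorem isEvenOrthogonal_monicOrthPoly {w : ℝ → ℝ}
    (hw : IntervalIntegrable w MeasureTheory.volume (-1) 1)
    (hpos : ∀ x ∈ Set.Ioo (-1 : ℝ) 1, 0 < w x) (heven : ∀ x, w (-x) = w x) :
    IsEvenOrthogonal (weightFunctional w hw) (monicOrthPoly w) (recurrenceCoeff w)
      (orthNormSq w) := by
  have H := isMonicOrthogonal_monicOrthPoly hw hpos
  have hp := weightFunctional_mul_self_pos hw hpos
  have he := weightFunctional_comp_neg_X hw heven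
  have hn : ∀ n, orthNormSq w n = weightFunctional w hw (monicOrthPoly w n * monicOrthPoly w n) :=
    fun n => weightedForm_eq hw _ _
  have hne : ∀ n, orthNormSq w n ≠ 0 := fun n => by
    rw [hn]; exact (hp _ (H.monic n).ne_zero).ne'
  refine ⟨H, fun n => (hn n).symm, hne, rfl, fun n => (div_mul_cancel₀ _ (hne n)).symm, ?_⟩
  intro n
  cases n with
  | zero => simpa [recurrenceCoeff] using H.X_mul_zero hp he
  | succ n =>
    rw [H.X_mul_succ hp he, ← hn, ← hn]
    rfl

end LaguerreFreud

/-! ### Weighted degrees of multivariate polynomials. -/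

namespace MvPolynomial

variable {ι : Type*} {R : Type*} [CommRing R] (w : ι → ℕ)

theorem weightedTotalDegree_add_le_of_le {p q : MvPolynomial ι R} {N : ℕ}
    (hp : p.weightedTotalDegree w ≤ N) (hq : q.weightedTotalDegree w ≤ N) :
    (p + q).weightedTotalDegree w ≤ N := by
  classical
  refine Finset.sup_le fun d hd => ?_
  rcases Finset.mem_union.mp (support_add hd) with h | h
  · exact (le_weightedTotalDegree w h).trans hp
  · exact (le_weightedTotalDegree w h).trans hq

theorem weightedTotalDegree_neg (p : MvPolynomial ι R) :
    (-p).weightedTotalDegree w = p.weightedTotalDegree w := by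
  rw [weightedTotalDegree, support_neg, weightedTotalDegree]

theorem weightedTotalDegree_sub_le_of_le {p q : MvPolynomial ι R} {N : ℕ}
    (hp : p.weightedTotalDegree w ≤ N) (hq : q.weightedTotalDegree w ≤ N) :
    (p - q).weightedTotalDegree w ≤ N := by
  rw [sub_eq_add_neg]
  exact weightedTotalDegree_add_le_of_le w hp (by rwa [weightedTotalDegree_neg])

theorem weightedTotalDegree_mul_le_of_le {p q : MvPolynomial ι R} {M N T : ℕ}
    (hp : p.weightedTotalDegree w ≤ M) (hq : q.weightedTotalDegree w ≤ N) (hT : M + N ≤ T) :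
    (p * q).weightedTotalDegree w ≤ T := by
  classical
  refine Finset.sup_le fun d hd => ?_
  obtain ⟨e, he, f, hf, rfl⟩ := Finset.mem_add.mp (support_mul p q hd)
  rw [map_add]
  exact (add_le_add ((le_weightedTotalDegree w he).trans hp)
    ((le_weightedTotalDegree w hf).trans hq)).trans hT

theorem weightedTotalDegree_C_le (c : R) (N : ℕ) :
    (C c : MvPolynomial ι R).weightedTotalDegree w ≤ N := by
  classical
  refine Finset.sup_le fun d hd => ?_
  rw [mem_support_iff, coeff_C] at hd
  obtain rfl : 0 = d := by by_contra h; simp [h] at hd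
  simp

theorem weightedTotalDegree_X_le (i : ι) {N : ℕ} (hN : w i ≤ N) :
    (X i : MvPolynomial ι R).weightedTotalDegree w ≤ N := by
  classical
  refine Finset.sup_le fun d hd => ?_
  rw [mem_support_iff, coeff_X] at hd
  obtain rfl : Finsupp.single i 1 = d := by by_contra h; simp [h] at hd
  simpa [Finsupp.weight_single] using hN

/-- Substituting `c_i t ^ (w i)` for the `i`-th variable gives a polynomial in `t` of degree at
most the weighted total degree. -/
theorem natDegree_aeval_le_weightedTotalDegree (c : ι → R) (p : MvPolynomial ι R) :
    (aeval (fun i => Polynomial.C (c i) * Polynomial.X ^ w i) p).natDegree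
      ≤ p.weightedTotalDegree w := by
  classical
  rw [aeval_def, eval₂_eq]
  refine Polynomial.natDegree_sum_le_of_forall_le _ _ fun d hd => ?_
  refine le_trans ?_ (le_weightedTotalDegree w hd)
  rw [Polynomial.algebraMap_eq]
  refine (Polynomial.natDegree_C_mul_le _ _).trans ?_
  refine (Polynomial.natDegree_prod_le _ _).trans ?_
  rw [Finsupp.weight_apply, Finsupp.sum]
  refine Finset.sum_le_sum fun i _ => ?_
  refine Polynomial.natDegree_pow_le.trans ?_
  rw [smul_eq_mul]
  exact Nat.mul_le_mul_left _ (Polynomial.natDegree_C_mul_X_pow_le _ _)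

theorem le_weightedTotalDegree_of_coeff_aeval (c : ι → R) (p : MvPolynomial ι R) (N : ℕ)
    (h : (aeval (fun i => Polynomial.C (c i) * Polynomial.X ^ w i) p).coeff N ≠ 0) :
    N ≤ p.weightedTotalDegree w :=
  (Polynomial.le_natDegree_of_ne_zero h).trans (natDegree_aeval_le_weightedTotalDegree w c p)

end MvPolynomial

/-! ### Degrees of the difference equation. -/

open MvPolynomial in
/-- The base of the square on the right-hand side, with `k² = K`. -/
noncomputable def thirdOrderBase (K s : ℝ) : MvPolynomial (Fin 4) ℝ :=
  C (K * (s + 5 / 2)) * (X 2 * X 3) - C (K * (s - 3 / 2)) * (X 0 * X 1)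
    + (C (K * (s + 5 / 2)) * (X 2 * X 2) + C (2 * K * (s + 1 / 2)) * (X 1 * X 2)
      - C (K * (3 * s - 1 / 2)) * (X 1 * X 1) - C ((K + 1) * (s + 3 / 2)) * X 2
      + C ((K + 1) * (s - 1 / 2)) * X 1 + C (1 / 2))

open MvPolynomial in
/-- The brace on the left-hand side, with `k² = K` and constant term `c`. -/
noncomputable def thirdOrderBrace (K s c : ℝ) : MvPolynomial (Fin 4) ℝ :=
  C (4 * K ^ 2 * (s + 3 / 2) * (s - 1 / 2)) * (X 1 * X 2)
    + C (4 * K ^ 2 * (s + 1 / 2) * (s - 3 / 2)) * (X 0 * X 1)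
    + C (8 * K ^ 2 * (s + 1 / 2) * (s - 1 / 2)) * (X 1 * X 1)
    - C (4 * K * (s + 1 / 2) * (s - 1 / 2) * (K + 1)) * X 1 + C c

open MvPolynomial in
/-- The difference of the two sides, with `k² = K`. -/
noncomputable def thirdOrderPoly (K s c : ℝ) : MvPolynomial (Fin 4) ℝ :=
  ((X 2 - X 1) * (X 2 - X 1)) * thirdOrderBrace K s c - thirdOrderBase K s * thirdOrderBase K s

open MvPolynomial in
theorem eval_thirdOrderPoly (a b k : ℝ) (n : ℕ) (v : Fin 4 → ℝ) :
    eval v (thirdOrderPoly (k ^ 2) (a + b + n)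
        ((a * k ^ 2 + b) ^ 2 + k ^ 2 * n * (n + 2 * a + 2 * b)))
      = thirdOrderLHS a b k n (v 0) (v 1) (v 2) (v 3)
        - thirdOrderRHS a b k n (v 0) (v 1) (v 2) (v 3) := by
  simp only [thirdOrderPoly, thirdOrderBrace, thirdOrderBase, thirdOrderLHS, thirdOrderRHS,
    map_add, map_sub, map_mul, eval_C, eval_X]
  ring

-- `B` bounds the base and the brace, `D` the factor `X 2 - X 1`. The joint degrees use `(B, D) =
-- (2, 1)` and `(1, 0)`.
open MvPolynomial in
theorem weightedTotalDegree_thirdOrderPoly_le (w : Fin 4 → ℕ) (B D N : ℕ) (K s c : ℝ)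
    (h23 : w 2 + w 3 ≤ B) (h01 : w 0 + w 1 ≤ B) (h22 : w 2 + w 2 ≤ B) (h12 : w 1 + w 2 ≤ B)
    (h11 : w 1 + w 1 ≤ B) (hN : B + B ≤ N) (hD1 : w 1 ≤ D) (hD2 : w 2 ≤ D)
    (hDN : D + D + B ≤ N) :
    (thirdOrderPoly K s c).weightedTotalDegree w ≤ N := by
  have hC : ∀ (r : ℝ) {p : MvPolynomial (Fin 4) ℝ}, p.weightedTotalDegree w ≤ B →
      (C r * p).weightedTotalDegree w ≤ B := fun r _ hp =>
    weightedTotalDegree_mul_le_of_le w (weightedTotalDegree_C_le w r 0) hp (by omega)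
  have hXX : ∀ i j : Fin 4, w i + w j ≤ B →
      (X i * X j : MvPolynomial (Fin 4) ℝ).weightedTotalDegree w ≤ B := fun i j hij =>
    weightedTotalDegree_mul_le_of_le w (weightedTotalDegree_X_le w i le_rfl)
      (weightedTotalDegree_X_le w j le_rfl) hij
  have hX : ∀ i : Fin 4, w i + w i ≤ B →
      (X i : MvPolynomial (Fin 4) ℝ).weightedTotalDegree w ≤ B := fun i hi =>
    weightedTotalDegree_X_le w i (by omega)
  have hc : ∀ r : ℝ, (C r : MvPolynomial (Fin 4) ℝ).weightedTotalDegree w ≤ B := fun r =>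
    weightedTotalDegree_C_le w r B
  have hadd := fun {p q : MvPolynomial (Fin 4) ℝ} {M : ℕ} =>
    weightedTotalDegree_add_le_of_le w (p := p) (q := q) (N := M)
  have hsub := fun {p q : MvPolynomial (Fin 4) ℝ} {M : ℕ} =>
    weightedTotalDegree_sub_le_of_le w (p := p) (q := q) (N := M)
  have hbase : (thirdOrderBase K s).weightedTotalDegree w ≤ B :=
    hadd (hsub (hC _ (hXX _ _ h23)) (hC _ (hXX _ _ h01)))
      (hadd (hadd (hsub (hsub (hadd (hC _ (hXX _ _ h22)) (hC _ (hXX _ _ h12)))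
        (hC _ (hXX _ _ h11))) (hC _ (hX _ h22))) (hC _ (hX _ h11))) (hc _))
  have hbrace : (thirdOrderBrace K s c).weightedTotalDegree w ≤ B :=
    hadd (hsub (hadd (hadd (hC _ (hXX _ _ h12)) (hC _ (hXX _ _ h01))) (hC _ (hXX _ _ h11)))
      (hC _ (hX _ h11))) (hc _)
  have hd : (X 2 - X 1 : MvPolynomial (Fin 4) ℝ).weightedTotalDegree w ≤ D :=
    hsub (weightedTotalDegree_X_le w 2 hD2) (weightedTotalDegree_X_le w 1 hD1)
  exact hsub (weightedTotalDegree_mul_le_of_le w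
    (weightedTotalDegree_mul_le_of_le w hd hd le_rfl) hbrace hDN)
    (weightedTotalDegree_mul_le_of_le w hbase hbase hN)

section LeadingCoefficients

open Polynomial

/-- Brace and base both contribute: `8(s + 1/2)(s - 1/2) - (3s - 1/2)² = -(s - 3/2)²`. -/
theorem coeff_aeval_thirdOrderPoly_one (K s c : ℝ) (f : Fin 4 → ℝ[X]) (h0 : f 0 = 0)
    (h1 : f 1 = X) (h2 : f 2 = 0) (h3 : f 3 = 0) :
    (MvPolynomial.aeval f (thirdOrderPoly K s c)).coeff 4 = -(K * (s - 3 / 2)) ^ 2 := by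
  have : MvPolynomial.aeval f (thirdOrderPoly K s c)
      = C (8 * K ^ 2 * (s + 1 / 2) * (s - 1 / 2) - (K * (3 * s - 1 / 2)) ^ 2) * X ^ 4
        + C (2 * (K * (3 * s - 1 / 2)) * ((K + 1) * (s - 1 / 2))
            - 4 * K * (s + 1 / 2) * (s - 1 / 2) * (K + 1)) * X ^ 3
        + C (c + 2 * (K * (3 * s - 1 / 2)) * (1 / 2) - ((K + 1) * (s - 1 / 2)) ^ 2) * X ^ 2
        - C (2 * ((K + 1) * (s - 1 / 2)) * (1 / 2)) * X - C ((1 / 2) ^ 2) := by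
    simp only [thirdOrderPoly, thirdOrderBrace, thirdOrderBase, map_add, map_sub, map_mul,
      MvPolynomial.aeval_C, MvPolynomial.aeval_X, h0, h1, h2, h3, Polynomial.algebraMap_eq,
      map_pow]
    simp only [map_ofNat, map_one]
    ring
  rw [this]
  simp only [coeff_add, coeff_sub, coeff_C_mul, coeff_X_pow, coeff_X, coeff_C]
  norm_num
  ring

/-- The brace is only linear in `β_{n-1}`, so the quadratic term comes from the square of the base
alone. -/
theorem coeff_aeval_thirdOrderPoly_zero (K s c : ℝ) (f : Fin 4 → ℝ[X]) (h0 : f 0 = X)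
    (h1 : f 1 = 1) (h2 : f 2 = 0) (h3 : f 3 = 0) :
    (MvPolynomial.aeval f (thirdOrderPoly K s c)).coeff 2 = -(K * (s - 3 / 2)) ^ 2 := by
  obtain ⟨d, e, h⟩ : ∃ d e : ℝ, MvPolynomial.aeval f (thirdOrderPoly K s c)
      = C (-(K * (s - 3 / 2)) ^ 2) * X ^ 2 + C d * X + C e := by
    refine ⟨4 * K ^ 2 * (s + 1 / 2) * (s - 3 / 2) + 2 * (K * (s - 3 / 2))
      * (-(K * (3 * s - 1 / 2)) + (K + 1) * (s - 1 / 2) + 1 / 2),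
      8 * K ^ 2 * (s + 1 / 2) * (s - 1 / 2) - 4 * K * (s + 1 / 2) * (s - 1 / 2) * (K + 1) + c
        - (-(K * (3 * s - 1 / 2)) + (K + 1) * (s - 1 / 2) + 1 / 2) ^ 2, ?_⟩
    simp only [thirdOrderPoly, thirdOrderBrace, thirdOrderBase, map_add, map_sub, map_mul,
      MvPolynomial.aeval_C, MvPolynomial.aeval_X, h0, h1, h2, h3, Polynomial.algebraMap_eq,
      map_pow, map_neg]
    simp only [map_ofNat, map_one]
    ring
  rw [h]
  simp only [coeff_add, coeff_C_mul, coeff_X_pow, coeff_X, coeff_C]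
  norm_num

theorem coeff_aeval_thirdOrderPoly_two (K s c : ℝ) (f : Fin 4 → ℝ[X]) (h0 : f 0 = 0)
    (h1 : f 1 = 0) (h2 : f 2 = X) (h3 : f 3 = 0) :
    (MvPolynomial.aeval f (thirdOrderPoly K s c)).coeff 4 = -(K * (s + 5 / 2)) ^ 2 := by
  obtain ⟨d, e, g, l, h⟩ : ∃ d e g l : ℝ, MvPolynomial.aeval f (thirdOrderPoly K s c)
      = C (-(K * (s + 5 / 2)) ^ 2) * X ^ 4 + C d * X ^ 3 + C e * X ^ 2 + C g * X + C l := by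
    refine ⟨2 * (K * (s + 5 / 2)) * ((K + 1) * (s + 3 / 2)),
      c - ((K + 1) * (s + 3 / 2)) ^ 2 - 2 * (K * (s + 5 / 2)) * (1 / 2),
      2 * ((K + 1) * (s + 3 / 2)) * (1 / 2), -(1 / 2) ^ 2, ?_⟩
    simp only [thirdOrderPoly, thirdOrderBrace, thirdOrderBase, map_add, map_sub, map_mul,
      MvPolynomial.aeval_C, MvPolynomial.aeval_X, h0, h1, h2, h3, Polynomial.algebraMap_eq,
      map_pow, map_neg]
    simp only [map_ofNat, map_one]
    ring
  rw [h]
  simp only [coeff_add, coeff_C_mul, coeff_X_pow, coeff_X, coeff_C]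
  norm_num

theorem coeff_aeval_thirdOrderPoly_three (K s c : ℝ) (f : Fin 4 → ℝ[X]) (h0 : f 0 = 0)
    (h1 : f 1 = 0) (h2 : f 2 = 1) (h3 : f 3 = X) :
    (MvPolynomial.aeval f (thirdOrderPoly K s c)).coeff 2 = -(K * (s + 5 / 2)) ^ 2 := by
  obtain ⟨d, e, h⟩ : ∃ d e : ℝ, MvPolynomial.aeval f (thirdOrderPoly K s c)
      = C (-(K * (s + 5 / 2)) ^ 2) * X ^ 2 + C d * X + C e := by
    refine ⟨-2 * (K * (s + 5 / 2)) * (K * (s + 5 / 2) - (K + 1) * (s + 3 / 2) + 1 / 2),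
      c - (K * (s + 5 / 2) - (K + 1) * (s + 3 / 2) + 1 / 2) ^ 2, ?_⟩
    simp only [thirdOrderPoly, thirdOrderBrace, thirdOrderBase, map_add, map_sub, map_mul,
      MvPolynomial.aeval_C, MvPolynomial.aeval_X, h0, h1, h2, h3, Polynomial.algebraMap_eq,
      map_pow, map_neg]
    simp only [map_ofNat, map_one]
    ring
  rw [h]
  simp only [coeff_add, coeff_C_mul, coeff_X_pow, coeff_X, coeff_C]
  norm_num

end LeadingCoefficients

theorem thirdOrderPoly_degrees {K : ℝ} (hK : 0 < K) (s c : ℝ) :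
    (thirdOrderPoly K s c).weightedTotalDegree (![0, 1, 1, 0] : Fin 4 → ℕ) = 4 ∧
    (thirdOrderPoly K s c).weightedTotalDegree (![1, 0, 0, 1] : Fin 4 → ℕ) = 2 ∧
    (s ≠ 3 / 2 → (thirdOrderPoly K s c).degreeOf 1 = 4 ∧ (thirdOrderPoly K s c).degreeOf 0 = 2) ∧
    (s ≠ -(5 / 2) →
      (thirdOrderPoly K s c).degreeOf 2 = 4 ∧ (thirdOrderPoly K s c).degreeOf 3 = 2) := by
  classical
  have hne1 : s ≠ 3 / 2 → -(K * (s - 3 / 2)) ^ 2 ≠ 0 := fun h =>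
    neg_ne_zero.mpr (pow_ne_zero 2 (mul_ne_zero hK.ne' (sub_ne_zero.mpr h)))
  have hne2 : s ≠ -(5 / 2) → -(K * (s + 5 / 2)) ^ 2 ≠ 0 := fun h =>
    neg_ne_zero.mpr (pow_ne_zero 2 (mul_ne_zero hK.ne' (by
      rwa [← sub_neg_eq_add, sub_ne_zero])))
  have hlow := MvPolynomial.le_weightedTotalDegree_of_coeff_aeval (R := ℝ) (ι := Fin 4)
  have l1 : ∀ w : Fin 4 → ℕ, w 1 = 1 → s ≠ 3 / 2 →
      4 ≤ (thirdOrderPoly K s c).weightedTotalDegree w := fun w hw h =>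
    hlow w ![0, 1, 0, 0] _ 4 (by
      rw [coeff_aeval_thirdOrderPoly_one]
      · exact hne1 h
      all_goals simp [hw])
  have l0 : ∀ w : Fin 4 → ℕ, w 0 = 1 → w 1 = 0 → s ≠ 3 / 2 →
      2 ≤ (thirdOrderPoly K s c).weightedTotalDegree w := fun w hw hw' h =>
    hlow w ![1, 1, 0, 0] _ 2 (by
      rw [coeff_aeval_thirdOrderPoly_zero]
      · exact hne1 h
      all_goals simp [hw, hw'])
  have l2 : ∀ w : Fin 4 → ℕ, w 2 = 1 → s ≠ -(5 / 2) →
      4 ≤ (thirdOrderPoly K s c).weightedTotalDegree w := fun w hw h =>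
    hlow w ![0, 0, 1, 0] _ 4 (by
      rw [coeff_aeval_thirdOrderPoly_two]
      · exact hne2 h
      all_goals simp [hw])
  have l3 : ∀ w : Fin 4 → ℕ, w 3 = 1 → w 2 = 0 → s ≠ -(5 / 2) →
      2 ≤ (thirdOrderPoly K s c).weightedTotalDegree w := fun w hw hw' h =>
    hlow w ![0, 0, 1, 1] _ 2 (by
      rw [coeff_aeval_thirdOrderPoly_three]
      · exact hne2 h
      all_goals simp [hw, hw'])
  have u4 : ∀ w : Fin 4 → ℕ, w 0 = 0 → w 1 ≤ 1 → w 2 ≤ 1 → w 3 = 0 →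
      (thirdOrderPoly K s c).weightedTotalDegree w ≤ 4 := fun w h0 h1 h2 h3 => by
    apply weightedTotalDegree_thirdOrderPoly_le w 2 1 4 <;> omega
  have u2 : ∀ w : Fin 4 → ℕ, w 0 ≤ 1 → w 1 = 0 → w 2 = 0 → w 3 ≤ 1 →
      (thirdOrderPoly K s c).weightedTotalDegree w ≤ 2 := fun w h0 h1 h2 h3 => by
    apply weightedTotalDegree_thirdOrderPoly_le w 1 0 2 <;> omega
  -- The two exceptional values of `s` differ, so one of the leading coefficients always survives
  -- and the joint degrees need no exception.
  have hs : s ≠ 3 / 2 ∨ s ≠ -(5 / 2) := by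
    by_contra! h
    linarith [h.1, h.2]
  -- The degree in one variable is the weighted degree for an indicator weight, so the same bounds
  -- apply.
  simp only [← MvPolynomial.weightedTotalDegree_piSingle]
  refine ⟨le_antisymm (u4 _ ?_ ?_ ?_ ?_) ?_, le_antisymm (u2 _ ?_ ?_ ?_ ?_) ?_, fun h =>
    ⟨le_antisymm (u4 _ ?_ ?_ ?_ ?_) (l1 _ ?_ h), le_antisymm (u2 _ ?_ ?_ ?_ ?_) (l0 _ ?_ ?_ h)⟩,
    fun h => ⟨le_antisymm (u4 _ ?_ ?_ ?_ ?_) (l2 _ ?_ h),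
      le_antisymm (u2 _ ?_ ?_ ?_ ?_) (l3 _ ?_ ?_ h)⟩⟩
  case refine_5 => exact hs.elim (l1 _ rfl) (l2 _ rfl)
  case refine_10 => exact hs.elim (l0 _ rfl rfl) (l3 _ rfl rfl)
  all_goals simp

theorem mainTheorem2 (a b k : ℝ) (ha : -1 < a) (hk0 : 0 < k ^ 2) (hk1 : k ^ 2 < 1)
    (β : ℕ → ℝ) (hβ : β = recurrenceCoeff (deformedJacobiWeight a b k)) :
    -- the difference equation for `n ≥ 1`
    (∀ n : ℕ, 1 ≤ n →
      thirdOrderLHS a b k n (β (n - 1)) (β n) (β (n + 1)) (β (n + 2))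
        = thirdOrderRHS a b k n (β (n - 1)) (β n) (β (n + 1)) (β (n + 2))) ∧
    -- the difference equation for `n = 0`, whatever value is given to `β_{-1}`
    (∀ z : ℝ, thirdOrderLHS a b k 0 z (β 0) (β 1) (β 2)
        = thirdOrderRHS a b k 0 z (β 0) (β 1) (β 2)) ∧
    -- its degrees; the variables `0, 1, 2, 3` are `β_{n-1}, β_n, β_{n+1}, β_{n+2}`
    (∀ n : ℕ, ∃ F : MvPolynomial (Fin 4) ℝ,
      (∀ v : Fin 4 → ℝ, MvPolynomial.eval v F
        = thirdOrderLHS a b k n (v 0) (v 1) (v 2) (v 3)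
          - thirdOrderRHS a b k n (v 0) (v 1) (v 2) (v 3)) ∧
      F.weightedTotalDegree (![0, 1, 1, 0] : Fin 4 → ℕ) = 4 ∧
      F.weightedTotalDegree (![1, 0, 0, 1] : Fin 4 → ℕ) = 2 ∧
      (a + b + n ≠ 3 / 2 → F.degreeOf 1 = 4 ∧ F.degreeOf 0 = 2) ∧
      (a + b + n ≠ -(5 / 2) → F.degreeOf 2 = 4 ∧ F.degreeOf 3 = 2)) := by
  subst hβ
  have H := isEvenOrthogonal_monicOrthPoly
    (deformedJacobiWeight_intervalIntegrable (a := a) (b := b) ha hk1)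
    (deformedJacobiWeight_pos hk1) (deformedJacobiWeight_neg a b k)
  have key := thirdOrder_of_ladder a b k hk0 hk1 _ H.zero
    (H.lfResidual_eq_zero a b (k ^ 2) (pearson_identity ha hk1))
  refine ⟨fun n _ => key n, fun z => ?_, fun n => ⟨_, eval_thirdOrderPoly a b k n,
    thirdOrderPoly_degrees hk0 _ _⟩⟩
  -- Here `β (0 - 1)` is `β 0`, but that argument occurs only multiplied by `β 0 = 0`, so any `z`
  -- may replace it.
  have h := key 0
  simp only [H.zero, thirdOrderLHS, thirdOrderRHS, mul_zero, zero_mul] at h ⊢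
  exact h
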